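/- All posets are finite. Let $P$ be a finite poset with least element $\hat 0$ and greatest element $\hat 1$ that is graded, with rank function $\rho$ ($\rho(\hat 0)=0$, and $\rho(y)=\rho(x)+1$ whenever $y$ covers $x$), and let $n=\rho(\hat 1)$ be its rank. Call $P$ *Eulerian* if every interval $[x,y]$ with $x<y$ has as many elements of even rank as of odd rank, and *triangular* if the number of maximal chains of an interval $[x,y]$ depends only on $\rho(x)$ and $\rho(y)$. Let $B_n$ be the lattice of all subsets of $\{1,\dots,n\}$ ordered by inclusion and, for an integer $\alpha\ge 1$, let $\boxplus^{\alpha}(B_n)$ be the poset obtained from $\alpha$ disjoint copies of $B_n$ by identifying all their least elements and identifying all their greatest elements. **Theorem.** Let $P$ be an Eulerian triangular poset of rank $n\ge 4$ such that every interval $[x,y]$ of $P$ with $\rho(y)=\rho(x)+3$ has exactly $6$ maximal chains. If $n$ is odd, then there is an integer $\alpha\ge 1$ such that $P$ is isomorphic to $\boxplus^{\alpha}(B_n)$. If $n$ is even, then $P$ is isomorphic to $B_n$. -/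

import Mathlib

/-- A graded poset is Eulerian if every non-singleton interval `[x, y]` has as many elements
of even rank as of odd rank. (`grade ℕ` is the rank function, with `grade ℕ ⊥ = 0`.) -/
def IsEulerian (P : Type*) [PartialOrder P] [GradeMinOrder ℕ P] : Prop :=
  ∀ x y : P, x < y →
    {z ∈ Set.Icc x y | Even (grade ℕ z)}.ncard = {z ∈ Set.Icc x y | Odd (grade ℕ z)}.ncard

/-- The number of maximal chains of the interval `[x, y]`. -/
noncomputable def numMaxChains {P : Type*} [PartialOrder P] (x y : P) : ℕ :=
  Nat.card (Flag (Set.Icc x y))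

/-- A graded poset is triangular if the number of maximal chains of an interval `[x, y]`
depends only on the rank of `x` and the rank of `y`. -/
def IsTriangular (P : Type*) [PartialOrder P] [GradeMinOrder ℕ P] : Prop :=
  ∀ x y u v : P, x ≤ y → u ≤ v → grade ℕ x = grade ℕ u → grade ℕ y = grade ℕ v →
    numMaxChains x y = numMaxChains u v

/-- The `k`-summation of a poset `Q` with distinct least and greatest elements: the disjoint union
of `k` copies of `Q`, with all the least elements identified and all the greatest elements
identified. The order on the `Σ`-type is that of a disjoint union: elements of different copies
are incomparable. -/
abbrev KSum (k : ℕ) (Q : Type*) [PartialOrder Q] [BoundedOrder Q] : Type _ :=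
  WithBot (WithTop (Σ _ : Fin k, {x : Q // x ≠ ⊥ ∧ x ≠ ⊤}))

/-- The boolean lattice of rank `n`: the subsets of an `n`-element set, ordered by inclusion. -/
abbrev BooleanLattice (n : ℕ) : Type := Finset (Fin n)

/-! Every interval of rank at least 3 is shown, by induction on its rank, to be boolean if the rank
is even, and semi-boolean if it is odd (all its proper lower and upper intervals are boolean).

Semi-boolean intervals of rank r at least 4 have a rigid structure. Call two atoms equivalent if
they have a common upper bound other than the top. This is an equivalence relation, each class has
exactly r atoms, and the elements strictly between the bounds correspond to the proper nonempty
subsets of the classes. So the interval is several copies of the boolean lattice glued at the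
bounds: it is boolean, or it has at least 2r atoms (`isBooleanInterval_or_le_card`).

Rank 3 is settled by the 6 maximal chains. In even rank n, triangularity makes the number p of atoms
of [v, y] the same for all atoms v, and the number q of atoms of [x, w] the same for all coatoms w.
Double counting makes the middle levels proportional to binomial coefficients, and the Euler
relation then links p, q and the numbers of atoms and coatoms. Since p and q are either n - 1 or at
least 2(n - 1), the only solution is the boolean one (`eq_of_atom_coatom_counts`). In odd rank the
Euler relation is not needed: proper intervals ending at a coatom or starting at an atom have even
rank, so they are boolean.

At the top level, the classes of atoms are the copies of the boolean lattice in the summation. -/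

section Grade

variable {P : Type*} [PartialOrder P] [GradeOrder ℕ P] {x y : P}

theorem grade_lt_of_lt (h : x < y) : grade ℕ x < grade ℕ y := grade_strictMono h

theorem grade_le_of_le (h : x ≤ y) : grade ℕ x ≤ grade ℕ y := grade_mono h

theorem eq_of_le_of_grade_le (h : x ≤ y) (hg : grade ℕ y ≤ grade ℕ x) : x = y := by
  by_contra hne
  exact absurd (grade_lt_of_lt (lt_of_le_of_ne h hne)) (by omega)

theorem grade_of_covBy (h : x ⋖ y) : grade ℕ y = grade ℕ x + 1 :=
  (Nat.covBy_iff_add_one_eq.mp (h.grade ℕ)).symm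

end Grade

set_option linter.unusedSectionVars false

/-! ### Levels of an interval, and boolean intervals. -/

section BooleanIntervals

variable {P : Type*} [PartialOrder P] [Fintype P] [GradeOrder ℕ P]

open Classical in
/-- The elements of the interval `[x, y]` whose rank relative to `x` is `k`. -/
noncomputable def level (x y : P) (k : ℕ) : Finset P :=
  {z | x ≤ z ∧ z ≤ y ∧ grade ℕ z = grade ℕ x + k}

theorem mem_level {x y z : P} {k : ℕ} :
    z ∈ level x y k ↔ x ≤ z ∧ z ≤ y ∧ grade ℕ z = grade ℕ x + k := by
  simp [level]

theorem level_zero {x y : P} (h : x ≤ y) : level x y 0 = {x} := by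
  ext z
  rw [mem_level, Finset.mem_singleton]
  constructor
  · rintro ⟨h₁, -, h₂⟩
    exact (eq_of_le_of_grade_le h₁ (by omega)).symm
  · rintro rfl
    exact ⟨le_rfl, h, rfl⟩

theorem level_top {x y : P} (h : x ≤ y) {k : ℕ} (hk : grade ℕ y = grade ℕ x + k) :
    level x y k = {y} := by
  ext z
  rw [mem_level, Finset.mem_singleton]
  constructor
  · rintro ⟨-, h₁, h₂⟩
    exact eq_of_le_of_grade_le h₁ (by omega)
  · rintro rfl
    exact ⟨h, le_rfl, hk⟩

theorem level_one_mono {x z w : P} (h : z ≤ w) : level x z 1 ⊆ level x w 1 := by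
  intro a ha
  rw [mem_level] at ha ⊢
  exact ⟨ha.1, ha.2.1.trans h, ha.2.2⟩

theorem level_one_nonempty {x y : P} (h : x < y) : (level x y 1).Nonempty := by
  obtain ⟨a, ha, hay⟩ := exists_covBy_le_of_lt h
  exact ⟨a, mem_level.2 ⟨ha.le, hay, grade_of_covBy ha⟩⟩

theorem level_one_self (x : P) : level x x 1 = ∅ := by
  ext z
  rw [mem_level]
  refine ⟨fun h => ?_, fun h => by simp at h⟩
  have := grade_le_of_le h.2.1
  omega

/-- Double counting of the pairs of an atom of `[x, y]` and an element of rank `k + 1` above it. -/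
theorem sum_card_level {x y : P} (k : ℕ) :
    ∑ v ∈ level x y 1, (level v y k).card = ∑ z ∈ level x y (k + 1), (level x z 1).card := by
  classical
  have h := Finset.sum_card_bipartiteAbove_eq_sum_card_bipartiteBelow (s := level x y 1)
    (t := level x y (k + 1)) (fun v z : P => v ≤ z)
  convert h using 2 with v hv z hz
  · congr 1
    ext z
    rw [mem_level] at hv
    simp only [Finset.bipartiteAbove, Finset.mem_filter, mem_level]
    constructor
    · rintro ⟨h₁, h₂, h₃⟩
      exact ⟨⟨hv.1.trans h₁, h₂, by omega⟩, h₁⟩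
    · rintro ⟨⟨h₁, h₂, h₃⟩, h₄⟩
      exact ⟨h₄, h₂, by omega⟩
  · congr 1
    ext v
    rw [mem_level] at hz
    simp only [Finset.bipartiteBelow, Finset.mem_filter, mem_level]
    constructor
    · rintro ⟨h₁, h₂, h₃⟩
      exact ⟨⟨h₁, h₂.trans hz.2.1, h₃⟩, h₂⟩
    · rintro ⟨⟨h₁, h₂, h₃⟩, h₄⟩
      exact ⟨h₁, h₄, h₃⟩

/-- The interval `[x, y]` is a boolean lattice: it is represented by the sets between two given
finite sets. -/
def IsBooleanInterval (x y : P) : Prop :=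
  ∃ f : P → Finset P,
    (∀ z w, x ≤ z → z ≤ y → x ≤ w → w ≤ y → (f z ⊆ f w ↔ z ≤ w)) ∧
      ∀ T, f x ⊆ T → T ⊆ f y → ∃ z, x ≤ z ∧ z ≤ y ∧ f z = T

/-- All intervals `[x, z]` and `[z, y]` with `x < z < y` are boolean. -/
def IsSemiBooleanInterval (x y : P) : Prop :=
  ∀ z, x < z → z < y → IsBooleanInterval x z ∧ IsBooleanInterval z y

namespace IsBooleanInterval

variable {x y : P}

theorem mono (h : IsBooleanInterval x y) {u v : P} (hxu : x ≤ u) (huv : u ≤ v) (hvy : v ≤ y) :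
    IsBooleanInterval u v := by
  obtain ⟨f, hf, hs⟩ := h
  have hu := huv.trans hvy
  have hv := hxu.trans huv
  refine ⟨f, fun z w h₁ h₂ h₃ h₄ =>
    hf z w (hxu.trans h₁) (h₂.trans hvy) (hxu.trans h₃) (h₄.trans hvy), fun T h₁ h₂ => ?_⟩
  obtain ⟨z, hz₁, hz₂, rfl⟩ := hs T
    (((hf x u le_rfl (hv.trans hvy) hxu hu).2 hxu).trans h₁)
    (h₂.trans ((hf v y hv hvy (hv.trans hvy) le_rfl).2 hvy))
  exact ⟨z, (hf u z hxu hu hz₁ hz₂).1 h₁, (hf z v hz₁ hz₂ hv hvy).1 h₂, rfl⟩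

theorem isSemiBooleanInterval (h : IsBooleanInterval x y) : IsSemiBooleanInterval x y :=
  fun _ h₁ h₂ => ⟨h.mono le_rfl h₁.le h₂.le, h.mono h₁.le h₂.le le_rfl⟩

/-- The representation `f` does not mention ranks. They are recovered by removing one element of `f
z` outside `f x`: the resulting set represents an element covered by `z`. -/
theorem grade_eq [DecidableEq P] {f : P → Finset P}
    (hf : ∀ z w, x ≤ z → z ≤ y → x ≤ w → w ≤ y → (f z ⊆ f w ↔ z ≤ w))
    (hs : ∀ T, f x ⊆ T → T ⊆ f y → ∃ z, x ≤ z ∧ z ≤ y ∧ f z = T) (hxy : x ≤ y) (n : ℕ) :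
    ∀ z, x ≤ z → z ≤ y → (f z \ f x).card = n → grade ℕ z = grade ℕ x + n := by
  induction n with
  | zero =>
    intro z h₁ h₂ h₃
    rw [Finset.card_eq_zero, Finset.sdiff_eq_empty_iff_subset] at h₃
    rw [le_antisymm ((hf z x h₁ h₂ le_rfl hxy).1 h₃) h₁, add_zero]
  | succ n ih =>
    intro z h₁ h₂ h₃
    obtain ⟨e, he⟩ : (f z \ f x).Nonempty := Finset.card_pos.1 (by omega)
    have hez := (Finset.mem_sdiff.1 he).1
    have hex := (Finset.mem_sdiff.1 he).2
    have hxz := (hf x z le_rfl hxy h₁ h₂).2 h₁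
    obtain ⟨w, hw₁, hw₂, hw₃⟩ := hs ((f z).erase e)
      (fun a ha => Finset.mem_erase.2 ⟨fun h => hex (h ▸ ha), hxz ha⟩)
      ((Finset.erase_subset _ _).trans ((hf z y h₁ h₂ hxy le_rfl).2 h₂))
    have hwz : w ≤ z := (hf w z hw₁ hw₂ h₁ h₂).1 (hw₃ ▸ Finset.erase_subset _ _)
    have hcov : w ⋖ z := by
      refine ⟨lt_of_le_of_ne hwz ?_, fun u hu₁ hu₂ => ?_⟩
      · rintro rfl
        exact Finset.notMem_erase e (f w) (hw₃ ▸ hez)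
      · have hxu := hw₁.trans hu₁.le
        have huy := hu₂.le.trans h₂
        have s₁ : f w ⊂ f u := ⟨(hf w u hw₁ hw₂ hxu huy).2 hu₁.le,
          fun h => hu₁.not_ge ((hf u w hxu huy hw₁ hw₂).1 h)⟩
        have s₂ : f u ⊂ f z := ⟨(hf u z hxu huy h₁ h₂).2 hu₂.le,
          fun h => hu₂.not_ge ((hf z u h₁ h₂ hxu huy).1 h)⟩
        have c₁ := Finset.card_lt_card s₁
        have c₂ := Finset.card_lt_card s₂
        rw [hw₃] at c₁
        have := Finset.card_erase_add_one hez
        omega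
    have hcard : (f w \ f x).card = n := by
      rw [hw₃, Finset.erase_sdiff_comm, Finset.card_erase_of_mem he, h₃, Nat.add_sub_cancel]
    rw [grade_of_covBy hcov, ih w hw₁ hw₂ hcard, add_assoc]

theorem card_level (h : IsBooleanInterval x y) (hxy : x ≤ y) (k : ℕ) :
    (level x y k).card = (grade ℕ y - grade ℕ x).choose k := by
  classical
  obtain ⟨f, hf, hs⟩ := h
  have hg := grade_eq hf hs hxy
  have hy : grade ℕ y - grade ℕ x = (f y \ f x).card := by
    rw [hg _ y hxy le_rfl rfl, Nat.add_sub_cancel_left]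
  rw [hy, ← Finset.card_powersetCard]
  refine Finset.card_bij (fun z _ => f z \ f x) ?_ ?_ ?_
  · intro z hz
    rw [mem_level] at hz
    rw [Finset.mem_powersetCard]
    refine ⟨Finset.sdiff_subset_sdiff ((hf z y hz.1 hz.2.1 hxy le_rfl).2 hz.2.1) subset_rfl, ?_⟩
    have := hg _ z hz.1 hz.2.1 rfl
    omega
  · intro z hz w hw hzw
    rw [mem_level] at hz hw
    have hz' := (hf x z le_rfl hxy hz.1 hz.2.1).2 hz.1
    have hw' := (hf x w le_rfl hxy hw.1 hw.2.1).2 hw.1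
    have : f z = f w := by
      rw [← Finset.sdiff_union_of_subset hz', ← Finset.sdiff_union_of_subset hw', hzw]
    exact le_antisymm ((hf z w hz.1 hz.2.1 hw.1 hw.2.1).1 this.le)
      ((hf w z hw.1 hw.2.1 hz.1 hz.2.1).1 this.ge)
  · intro T hT
    rw [Finset.mem_powersetCard] at hT
    have hdis : Disjoint T (f x) := Finset.disjoint_of_subset_left hT.1 Finset.sdiff_disjoint
    obtain ⟨z, h₁, h₂, h₃⟩ := hs (T ∪ f x) Finset.subset_union_right
      (Finset.union_subset (hT.1.trans Finset.sdiff_subset) ((hf x y le_rfl hxy hxy le_rfl).2 hxy))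
    have hTz : f z \ f x = T := by rw [h₃, Finset.union_sdiff_cancel_right hdis]
    exact ⟨z, mem_level.2 ⟨h₁, h₂, hg _ z h₁ h₂ (by rw [hTz, hT.2])⟩, hTz⟩

theorem card_level_one (h : IsBooleanInterval x y) (hxy : x ≤ y) :
    (level x y 1).card = grade ℕ y - grade ℕ x := by
  rw [h.card_level hxy, Nat.choose_one_right]

/-- In a boolean interval, elements are ordered as their sets of atoms. -/
theorem le_of_level_one_subset (h : IsBooleanInterval x y) {z w : P} (hxz : x ≤ z) (hzy : z ≤ y)
    (hxw : x ≤ w) (hwy : w ≤ y) (hs : level x z 1 ⊆ level x w 1) : z ≤ w := by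
  classical
  obtain ⟨f, hf, hs'⟩ := h
  have hxy := hxz.trans hzy
  have hg := grade_eq hf hs' hxy
  refine (hf z w hxz hzy hxw hwy).1 fun e he => ?_
  by_cases hex : e ∈ f x
  · exact (hf x w le_rfl hxy hxw hwy).2 hxw hex
  obtain ⟨a, h₁, h₂, h₃⟩ := hs' (insert e (f x)) (Finset.subset_insert _ _)
    (Finset.insert_subset ((hf z y hxz hzy hxy le_rfl).2 hzy he)
      ((hf x y le_rfl hxy hxy le_rfl).2 hxy))
  have haz : a ≤ z := (hf a z h₁ h₂ hxz hzy).1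
    (h₃ ▸ Finset.insert_subset he ((hf x z le_rfl hxy hxz hzy).2 hxz))
  have hga := hg 1 a h₁ h₂ (by rw [h₃, Finset.insert_sdiff_of_notMem _ hex]; simp)
  have haw := (mem_level.1 (hs (mem_level.2 ⟨h₁, haz, hga⟩))).2.1
  exact (hf a w h₁ h₂ hxw hwy).2 haw (h₃ ▸ Finset.mem_insert_self _ _)

/-- In a boolean interval, every set of atoms is the set of atoms below some element. -/
theorem exists_level_one_eq (h : IsBooleanInterval x y) (hxy : x ≤ y) {T : Finset P}
    (hT : T ⊆ level x y 1) : ∃ z, x ≤ z ∧ z ≤ y ∧ level x z 1 = T := by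
  classical
  obtain ⟨f, hf, hs'⟩ := h
  have hg := grade_eq hf hs' hxy
  have hfx : ∀ z, x ≤ z → z ≤ y → f x ⊆ f z := fun z h₁ h₂ => (hf x z le_rfl hxy h₁ h₂).2 h₁
  have hfy : ∀ z, x ≤ z → z ≤ y → f z ⊆ f y := fun z h₁ h₂ => (hf z y h₁ h₂ hxy le_rfl).2 h₂
  -- The union represents the join of `T`; the term `f x` matters only when `T` is empty.
  obtain ⟨z, h₁, h₂, h₃⟩ := hs' (T.biUnion f ∪ f x) Finset.subset_union_right
    (Finset.union_subset (Finset.biUnion_subset.2 fun a ha =>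
      hfy a (mem_level.1 (hT ha)).1 (mem_level.1 (hT ha)).2.1) (hfx y hxy le_rfl))
  refine ⟨z, h₁, h₂, Finset.Subset.antisymm (fun a ha => ?_) (fun a ha => ?_)⟩
  · rw [mem_level] at ha
    have hay := ha.2.1.trans h₂
    have hnot : ¬ f a ⊆ f x := fun h => by
      have := grade_le_of_le ((hf a x ha.1 hay le_rfl hxy).1 h)
      omega
    obtain ⟨e, hea, hex⟩ := Finset.not_subset.1 hnot
    have hez := (hf a z ha.1 hay h₁ h₂).2 ha.2.1 hea
    rw [h₃, Finset.mem_union, Finset.mem_biUnion] at hez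
    obtain ⟨b, hbT, heb⟩ := hez.resolve_right hex
    have hb := mem_level.1 (hT hbT)
    -- An atom adds a single element to `f x`, so an atom `b` of `T` whose set contains that element
    -- is `a` itself.
    have c₁ : (f a \ f x).card = 1 := by have := hg _ a ha.1 hay rfl; omega
    obtain ⟨e', he'⟩ := Finset.card_eq_one.1 c₁
    have hee' : e = e' := Finset.mem_singleton.1 (he' ▸ Finset.mem_sdiff.2 ⟨hea, hex⟩)
    have hab : a ≤ b := by
      refine (hf a b ha.1 hay hb.1 hb.2.1).1 fun u hu => ?_
      by_cases hux : u ∈ f x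
      · exact hfx b hb.1 hb.2.1 hux
      · have : u = e' := Finset.mem_singleton.1 (he' ▸ Finset.mem_sdiff.2 ⟨hu, hux⟩)
        rwa [this, ← hee']
    rwa [eq_of_le_of_grade_le hab (by omega)]
  · have hb := mem_level.1 (hT ha)
    refine mem_level.2 ⟨hb.1, (hf a z hb.1 hb.2.1 h₁ h₂).1 ?_, hb.2.2⟩
    rw [h₃]
    exact (Finset.subset_biUnion_of_mem f ha).trans Finset.subset_union_left

end IsBooleanInterval

end BooleanIntervals

/-! ### Structure of semi-boolean intervals: classes of atoms. -/

section SemiBooleanIntervals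

variable {P : Type*} [PartialOrder P] [Fintype P] [GradeOrder ℕ P] {x y : P}

open Classical in
/-- The atoms of `[x, y]` having an upper bound below `y` in common with `v`. -/
noncomputable def atomClass (x y v : P) : Finset P :=
  {w ∈ level x y 1 | ∃ z, z < y ∧ v ≤ z ∧ w ≤ z}

theorem mem_atomClass {v w : P} :
    w ∈ atomClass x y v ↔ w ∈ level x y 1 ∧ ∃ z, z < y ∧ v ≤ z ∧ w ≤ z := by
  simp [atomClass]

theorem level_one_subset_atomClass {v z : P} (hzy : z < y) (hv : v ≤ z) :
    level x z 1 ⊆ atomClass x y v := fun _ hw =>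
  mem_atomClass.2 ⟨level_one_mono hzy.le hw, z, hzy, hv, (mem_level.1 hw).2.1⟩

theorem lt_of_mem_level_one {v : P} (hv : v ∈ level x y 1) : x < v := by
  rw [mem_level] at hv
  exact lt_of_le_of_ne hv.1 fun h => by have := hv.2.2; rw [← h] at this; omega

theorem lt_top_of_mem_level_one {v : P} (hv : v ∈ level x y 1) (hn : grade ℕ x + 2 ≤ grade ℕ y) :
    v < y := by
  rw [mem_level] at hv
  exact lt_of_le_of_ne hv.2.1 fun h => by have := hv.2.2; rw [h] at this; omega

namespace IsSemiBooleanInterval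

theorem card_level_one (h : IsSemiBooleanInterval x y) {z : P} (hxz : x ≤ z) (hzy : z < y) :
    (level x z 1).card = grade ℕ z - grade ℕ x := by
  rcases hxz.eq_or_lt with rfl | hlt
  · simp [level_one_self]
  · exact (h z hlt hzy).1.card_level_one hxz

/-- The atoms behave like vertices of a graph whose edges are the elements of rank 2: inside the
boolean interval [x, z], the join of `v` and `w` is an edge with these two ends. -/
theorem exists_edge [DecidableEq P] (h : IsSemiBooleanInterval x y) {v w z : P} (hv : v ∈ level x y 1)
    (hw : w ∈ level x y 1) (hvw : v ≠ w) (hzy : z < y) (hvz : v ≤ z) (hwz : w ≤ z) :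
    ∃ e ∈ level v y 1, e ≤ z ∧ w ≤ e ∧ level x e 1 = {v, w} := by
  have hxv := lt_of_mem_level_one hv
  have hxz := hxv.trans_le hvz
  rw [mem_level] at hv hw
  obtain ⟨e, h₁, h₂, h₃⟩ := (h z hxz hzy).1.exists_level_one_eq hxz.le (T := {v, w}) (by
    intro a ha
    rw [Finset.mem_insert, Finset.mem_singleton] at ha
    rcases ha with rfl | rfl
    · exact mem_level.2 ⟨hv.1, hvz, hv.2.2⟩
    · exact mem_level.2 ⟨hw.1, hwz, hw.2.2⟩)
  have hve : v ∈ level x e 1 := by simp [h₃]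
  have hwe : w ∈ level x e 1 := by simp [h₃]
  have hc := h.card_level_one h₁ (h₂.trans_lt hzy)
  rw [h₃, Finset.card_pair hvw] at hc
  rw [mem_level] at hve hwe
  exact ⟨e, mem_level.2 ⟨hve.2.1, h₂.trans hzy.le, by omega⟩, h₂, hwe.2.1, h₃⟩

section RankAtLeastFour

variable (h : IsSemiBooleanInterval x y) (hn : grade ℕ x + 4 ≤ grade ℕ y)
include h hn

/-- In the boolean interval [v, y] the join of two edges at `v` has rank at most 2 above `v`, hence
at most 3 above `x`. Rank at least 4 keeps it below `y`. -/
theorem exists_join {v e e' : P} (hv : v ∈ level x y 1) (he : e ∈ level v y 1)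
    (he' : e' ∈ level v y 1) : ∃ t, t < y ∧ e ≤ t ∧ e' ≤ t := by
  classical
  have hb := (h v (lt_of_mem_level_one hv) (lt_top_of_mem_level_one hv (by omega))).2
  obtain ⟨t, h₁, h₂, h₃⟩ := hb.exists_level_one_eq (mem_level.1 hv).2.1 (T := {e, e'}) (by
    intro a ha
    rw [Finset.mem_insert, Finset.mem_singleton] at ha
    rcases ha with rfl | rfl <;> assumption)
  have hc := (hb.mono le_rfl h₁ h₂).card_level_one h₁
  rw [h₃] at hc
  have hc' := Finset.card_le_two (a := e) (b := e')
  have hv' := (mem_level.1 hv).2.2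
  refine ⟨t, lt_of_le_of_ne h₂ fun h => ?_, ?_, ?_⟩
  · rw [h] at hc
    omega
  · exact (mem_level.1 (h₃ ▸ Finset.mem_insert_self e _ : e ∈ level v t 1)).2.1
  · exact (mem_level.1 (h₃ ▸ Finset.mem_insert_of_mem (Finset.mem_singleton_self e') :
      e' ∈ level v t 1)).2.1

/-- Both edges lie in one boolean interval [x, t] with `t < y`, where atoms determine elements. -/
theorem edge_unique {v e e' : P} (hv : v ∈ level x y 1) (he : e ∈ level v y 1)
    (he' : e' ∈ level v y 1) (hee : level x e 1 = level x e' 1) : e = e' := by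
  obtain ⟨t, ht, h₁, h₂⟩ := h.exists_join hn hv he he'
  have hxv := lt_of_mem_level_one hv
  have hxe := hxv.le.trans (mem_level.1 he).1
  have hxe' := hxv.le.trans (mem_level.1 he').1
  have hb := (h t (hxv.trans_le ((mem_level.1 he).1.trans h₁)) ht).1
  exact le_antisymm (hb.le_of_level_one_subset hxe h₁ hxe' h₂ hee.le)
    (hb.le_of_level_one_subset hxe' h₂ hxe h₁ hee.ge)

theorem mem_atomClass_self {v : P} (hv : v ∈ level x y 1) : v ∈ atomClass x y v :=
  mem_atomClass.2 ⟨hv, v, lt_top_of_mem_level_one hv (by omega), le_rfl, le_rfl⟩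

/-- The edges joining `v` to `u` and to `w` have a common upper bound below `y`, which bounds `u`
and `w`. Symmetry is the special case `w = v`. -/
theorem atomClass_trans {u v w : P} (hv : v ∈ level x y 1) (hu : u ∈ atomClass x y v)
    (hw : w ∈ atomClass x y v) : w ∈ atomClass x y u := by
  classical
  rw [mem_atomClass] at hu hw
  obtain ⟨hu, z, hz, hvz, huz⟩ := hu
  obtain ⟨hw, z', hz', hvz', hwz'⟩ := hw
  by_cases hvu : v = u
  · exact mem_atomClass.2 ⟨hw, z', hz', hvu ▸ hvz', hwz'⟩
  by_cases hvw : v = w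
  · exact mem_atomClass.2 ⟨hw, z, hz, huz, hvw ▸ hvz⟩
  obtain ⟨e, he, -, hue, -⟩ := h.exists_edge hv hu hvu hz hvz huz
  obtain ⟨e', he', -, hwe, -⟩ := h.exists_edge hv hw hvw hz' hvz' hwz'
  obtain ⟨t, ht, h₁, h₂⟩ := h.exists_join hn hv he he'
  exact mem_atomClass.2 ⟨hw, t, ht, hue.trans h₁, hwe.trans h₂⟩

theorem atomClass_comm {v w : P} (hv : v ∈ level x y 1) (hw : w ∈ atomClass x y v) :
    v ∈ atomClass x y w :=
  h.atomClass_trans hn hv hw (h.mem_atomClass_self hn hv)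

theorem atomClass_eq {v w : P} (hv : v ∈ level x y 1) (hw : w ∈ atomClass x y v) :
    atomClass x y w = atomClass x y v :=
  Finset.Subset.antisymm
    (fun _ hu => h.atomClass_trans hn (mem_atomClass.1 hw).1 (h.atomClass_comm hn hv hw) hu)
    (fun _ hu => h.atomClass_trans hn hv hw hu)

theorem exists_level_one_eq_pair [DecidableEq P] {v e : P} (hv : v ∈ level x y 1)
    (he : e ∈ level v y 1) :
    ∃ w ∈ atomClass x y v, w ≠ v ∧ level x e 1 = {v, w} := by
  have hxv := lt_of_mem_level_one hv
  rw [mem_level] at hv he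
  have hey : e < y := lt_of_le_of_ne he.2.1 fun h => by
    have := he.2.2
    rw [h] at this
    omega
  have hc := h.card_level_one (hxv.le.trans he.1) hey
  have hve : v ∈ level x e 1 := mem_level.2 ⟨hv.1, he.1, hv.2.2⟩
  have hc' := Finset.card_erase_add_one hve
  obtain ⟨w, hw⟩ := Finset.card_eq_one.1 (by omega : ((level x e 1).erase v).card = 1)
  have hwe : w ∈ (level x e 1).erase v := hw ▸ Finset.mem_singleton_self w
  rw [Finset.mem_erase] at hwe
  refine ⟨w, level_one_subset_atomClass hey he.1 hwe.2, hwe.1, ?_⟩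
  rw [← hw, Finset.insert_erase hve]

/-- The other atoms of the class correspond to the edges at `v`, which are the atoms of the boolean
interval [v, y], of rank one less. -/
theorem card_atomClass {v : P} (hv : v ∈ level x y 1) :
    (atomClass x y v).card = grade ℕ y - grade ℕ x := by
  classical
  have hvy := lt_top_of_mem_level_one hv (by omega)
  have hc := (h v (lt_of_mem_level_one hv) hvy).2.card_level_one hvy.le
  have hvK := h.mem_atomClass_self hn hv
  have hg := (mem_level.1 hv).2.2
  suffices hcard : ((atomClass x y v).erase v).card = (level v y 1).card by
    have := Finset.card_erase_add_one hvK
    omega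
  have hedge : ∀ w ∈ (atomClass x y v).erase v, ∃ e ∈ level v y 1, level x e 1 = {v, w} := by
    intro w hw
    rw [Finset.mem_erase, mem_atomClass] at hw
    obtain ⟨hwv, hw, z, hz, hvz, hwz⟩ := hw
    obtain ⟨e, he, -, -, hp⟩ := h.exists_edge hv hw (Ne.symm hwv) hz hvz hwz
    exact ⟨e, he, hp⟩
  choose! e he hp using hedge
  refine Finset.card_bij (fun w _ => e w) he ?_ ?_
  · intro w hw u hu hwu
    have : w ∈ ({v, u} : Finset P) := by
      rw [← hp u hu, ← hwu, hp w hw]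
      simp
    rw [Finset.mem_insert, Finset.mem_singleton] at this
    exact this.resolve_left (Finset.ne_of_mem_erase hw)
  · intro e' he'
    obtain ⟨w, hw, hwv, hw'⟩ := h.exists_level_one_eq_pair hn hv he'
    have hwe := Finset.mem_erase.2 ⟨hwv, hw⟩
    exact ⟨w, hwe, h.edge_unique hn hv (he w hwe) he' ((hp w hwe).trans hw'.symm)⟩

/-- Below the top of a semi-boolean interval, elements are ordered as their sets of atoms. -/
theorem le_of_level_one_subset {z w : P} (hxz : x ≤ z) (hzy : z < y) (hxw : x ≤ w) (hwy : w < y)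
    (hs : level x z 1 ⊆ level x w 1) : z ≤ w := by
  classical
  rcases hxz.eq_or_lt with rfl | hxz
  · exact hxw
  obtain ⟨v, hvz⟩ := level_one_nonempty hxz
  have hvw := hs hvz
  have hv := level_one_mono hzy.le hvz
  rw [mem_level] at hvz hvw
  have hvy := hvz.2.1.trans_lt hzy
  have hb := (h v (lt_of_mem_level_one hv) hvy).2
  refine hb.le_of_level_one_subset hvz.2.1 hzy.le hvw.2.1 hwy.le fun e he => ?_
  -- An edge `e` at `v` below `z` has its other end `u` below `w` as well; the edge from `v` to `u`
  -- below `w` is `e` by uniqueness.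
  have hey := level_one_mono hzy.le he
  obtain ⟨u, hu, huv, hue⟩ := h.exists_level_one_eq_pair hn hv hey
  rw [mem_level] at he
  have huw : u ∈ level x w 1 := hs (level_one_mono he.2.1 (by simp [hue]))
  obtain ⟨e', he', hew, -, hp⟩ := h.exists_edge hv (mem_atomClass.1 hu).1 huv.symm hwy hvw.2.1
    (mem_level.1 huw).2.1
  rw [h.edge_unique hn hv hey he' (hue.trans hp.symm)]
  exact mem_level.2 ⟨(mem_level.1 he').1, hew, (mem_level.1 he').2.2⟩

/-- Every proper nonempty subset of a class of atoms is the set of atoms below some element. -/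
theorem exists_level_one_eq {v : P} (hv : v ∈ level x y 1) {T : Finset P} (hvT : v ∈ T)
    (hT : T ⊂ atomClass x y v) : ∃ z, x < z ∧ z < y ∧ level x z 1 = T := by
  classical
  have hvy := lt_top_of_mem_level_one hv (by omega)
  have hxv := lt_of_mem_level_one hv
  -- `z` is the join, in the boolean interval [v, y], of the edges from `v` to the other atoms of
  -- `T`.
  obtain ⟨z, h₁, h₂, h₃⟩ := (h v hxv hvy).2.exists_level_one_eq hvy.le
    (T := {e ∈ level v y 1 | ∃ w ∈ T, w ≠ v ∧ w ≤ e}) (Finset.filter_subset _ _)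
  have key : ∀ w ∈ atomClass x y v, w ≠ v → ∀ e ∈ level v y 1, w ≤ e → e ≤ z → w ∈ T := by
    intro w hw hwv e he hwe hez
    have : e ∈ level v z 1 := mem_level.2 ⟨(mem_level.1 he).1, hez, (mem_level.1 he).2.2⟩
    rw [h₃, Finset.mem_filter] at this
    obtain ⟨-, u, huT, huv, hue⟩ := this
    obtain ⟨u', -, -, hp⟩ := h.exists_level_one_eq_pair hn hv he
    have hw' : w ∈ level x e 1 :=
      mem_level.2 ⟨(mem_level.1 (mem_atomClass.1 hw).1).1, hwe,
        (mem_level.1 (mem_atomClass.1 hw).1).2.2⟩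
    have huK := mem_level.1 (mem_atomClass.1 (hT.1 huT)).1
    have hu' : u ∈ level x e 1 := mem_level.2 ⟨huK.1, hue, huK.2.2⟩
    rw [hp, Finset.mem_insert, Finset.mem_singleton] at hw' hu'
    rw [hw'.resolve_left hwv, ← hu'.resolve_left huv]
    exact huT
  have hzy : z < y := by
    -- If `z` were `y`, every edge at `v` would lie below `z`, and `T` would be the whole class.
    refine lt_of_le_of_ne h₂ fun hzy => hT.2 fun w hw => ?_
    by_cases hwv : w = v
    · exact hwv ▸ hvT
    obtain ⟨hwa, t, ht, hvt, hwt⟩ := mem_atomClass.1 hw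
    obtain ⟨e, he, -, hwe, -⟩ := h.exists_edge hv hwa (Ne.symm hwv) ht hvt hwt
    exact key w hw hwv e he hwe (hzy ▸ (mem_level.1 he).2.1)
  refine ⟨z, hxv.trans_le h₁, hzy, Finset.Subset.antisymm (fun w hw => ?_) fun w hw => ?_⟩
  · by_cases hwv : w = v
    · exact hwv ▸ hvT
    have hwK := level_one_subset_atomClass hzy h₁ hw
    obtain ⟨e, he, hez, hwe, -⟩ := h.exists_edge hv (mem_atomClass.1 hwK).1 (Ne.symm hwv) hzy h₁
      (mem_level.1 hw).2.1
    exact key w hwK hwv e he hwe hez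
  · obtain ⟨hwa, t, ht, hvt, hwt⟩ := mem_atomClass.1 (hT.1 hw)
    have hwa' := mem_level.1 hwa
    refine mem_level.2 ⟨hwa'.1, ?_, hwa'.2.2⟩
    by_cases hwv : w = v
    · exact hwv ▸ h₁
    obtain ⟨e, he, -, hwe, -⟩ := h.exists_edge hv hwa (Ne.symm hwv) ht hvt hwt
    have : e ∈ level v z 1 := by
      rw [h₃, Finset.mem_filter]
      exact ⟨he, w, hw, hwv, hwe⟩
    exact hwe.trans (mem_level.1 this).2.1

theorem level_one_ssubset_atomClass {v z : P} (hxz : x ≤ z) (hzy : z < y) (hv : v ∈ level x z 1) :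
    level x z 1 ⊂ atomClass x y v := by
  refine Finset.ssubset_iff_subset_ne.2
    ⟨level_one_subset_atomClass hzy (mem_level.1 hv).2.1, fun he => ?_⟩
  have h₁ := h.card_level_one hxz hzy
  have h₂ := h.card_atomClass hn (level_one_mono hzy.le hv)
  have h₃ := grade_lt_of_lt hzy
  have h₄ := grade_le_of_le hxz
  rw [he] at h₁
  omega

theorem isBooleanInterval_of_level_one_eq {v : P} (hv : v ∈ level x y 1)
    (hA : level x y 1 = atomClass x y v) : IsBooleanInterval x y := by
  have hxy : x < y := (lt_of_mem_level_one hv).trans (lt_top_of_mem_level_one hv (by omega))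
  refine ⟨fun z => level x z 1, fun z w hxz hzy hxw hwy => ⟨fun hs => ?_, level_one_mono⟩,
    fun T _ hT => ?_⟩
  · rcases hwy.eq_or_lt with rfl | hwy
    · exact hzy
    rcases hzy.eq_or_lt with rfl | hzy
    -- An element `w` strictly below the top has too few atoms to contain the whole class.
    · have h₁ := h.card_level_one hxw hwy
      have h₂ := h.card_atomClass hn hv
      have h₃ := grade_lt_of_lt hwy
      have h₄ := Finset.card_le_card hs
      have h₅ := grade_le_of_le hxw
      simp only [hA] at h₄
      omega
    · exact h.le_of_level_one_subset hn hxz hzy hxw hwy hs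
  · rcases T.eq_empty_or_nonempty with rfl | ⟨w, hw⟩
    · exact ⟨x, le_rfl, hxy.le, level_one_self x⟩
    rcases eq_or_ne T (level x y 1) with rfl | hne
    · exact ⟨y, hxy.le, le_rfl, rfl⟩
    have hT' : T ⊂ atomClass x y w := by
      rw [h.atomClass_eq hn hv (hA ▸ hT hw), ← hA]
      exact Finset.ssubset_iff_subset_ne.2 ⟨hT, hne⟩
    obtain ⟨z, h₁, h₂, h₃⟩ := h.exists_level_one_eq hn (hT hw) hw hT'
    exact ⟨z, h₁.le, h₂.le, h₃⟩

/-- A semi-boolean interval of rank `m` is boolean or has at least `2 * m` atoms. -/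
theorem isBooleanInterval_or_le_card (hxy : x < y) : IsBooleanInterval x y ∨
    2 * (grade ℕ y - grade ℕ x) ≤ (level x y 1).card := by
  classical
  obtain ⟨v, hv⟩ := level_one_nonempty hxy
  have hvK : atomClass x y v ⊆ level x y 1 := Finset.filter_subset _ _
  by_cases hA : level x y 1 ⊆ atomClass x y v
  · exact Or.inl (h.isBooleanInterval_of_level_one_eq hn hv (Finset.Subset.antisymm hA hvK))
  obtain ⟨u, hu, huv⟩ := Finset.not_subset.1 hA
  have huK : atomClass x y u ⊆ level x y 1 := Finset.filter_subset _ _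
  have hdis : Disjoint (atomClass x y v) (atomClass x y u) := by
    rw [Finset.disjoint_left]
    intro w hwv hwu
    rw [← h.atomClass_eq hn hv hwv, h.atomClass_eq hn hu hwu] at huv
    exact huv (h.mem_atomClass_self hn hu)
  have hc := Finset.card_le_card (Finset.union_subset hvK huK)
  rw [Finset.card_union_of_disjoint hdis, h.card_atomClass hn hv, h.card_atomClass hn hu] at hc
  exact Or.inr (by omega)

end RankAtLeastFour

end IsSemiBooleanInterval

end SemiBooleanIntervals

/-! ### Counting maximal chains recursively. -/

section MaximalChains

variable {P : Type*} [PartialOrder P] [Fintype P] {x y : P}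

open Classical in
/-- The maximal chains of the interval `[x, y]`, as sets of elements of the poset. -/
noncomputable def maxChains (x y : P) : Finset (Finset P) :=
  {C | (∀ c ∈ C, x ≤ c ∧ c ≤ y) ∧ (∀ c ∈ C, ∀ d ∈ C, c ≤ d ∨ d ≤ c) ∧
    ∀ u, x ≤ u → u ≤ y → (∀ c ∈ C, c ≤ u ∨ u ≤ c) → u ∈ C}

theorem mem_maxChains {C : Finset P} : C ∈ maxChains x y ↔
    (∀ c ∈ C, x ≤ c ∧ c ≤ y) ∧ (∀ c ∈ C, ∀ d ∈ C, c ≤ d ∨ d ≤ c) ∧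
      ∀ u, x ≤ u → u ≤ y → (∀ c ∈ C, c ≤ u ∨ u ≤ c) → u ∈ C := by
  simp [maxChains]

/-- Flags of different intervals live in different subtypes. As finite sets of elements of `P` they
can be compared, and `x` can be inserted or erased. -/
theorem numMaxChains_eq_card_maxChains (x y : P) : numMaxChains x y = (maxChains x y).card := by
  classical
  have := Fintype.ofFinite (Flag (Set.Icc x y))
  rw [numMaxChains, Nat.card_eq_fintype_card, ← Finset.card_univ]
  refine Finset.card_bij
    (fun s _ => (Subtype.val '' (s : Set (Set.Icc x y))).toFinset) ?_ ?_ ?_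
  · intro s _
    rw [mem_maxChains]
    refine ⟨fun c hc => ?_, fun c hc d hd => ?_, fun u hxu huy hu => ?_⟩
    · rw [Set.mem_toFinset] at hc
      obtain ⟨c, -, rfl⟩ := hc
      exact c.2
    · rw [Set.mem_toFinset] at hc hd
      obtain ⟨c, hc, rfl⟩ := hc
      obtain ⟨d, hd, rfl⟩ := hd
      exact s.le_or_le hc hd
    · rw [Set.mem_toFinset]
      refine ⟨⟨u, hxu, huy⟩, ?_, rfl⟩
      have hchain : IsChain (· ≤ ·) (insert ⟨u, hxu, huy⟩ (s : Set (Set.Icc x y))) :=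
        s.chain_le.insert fun b hb _ =>
          (hu b (Set.mem_toFinset.2 ⟨b, hb, rfl⟩)).symm
      have := s.maxChain.2 hchain (Set.subset_insert _ _)
      rw [this]
      exact Set.mem_insert _ _
  · intro s _ t _ hst
    rw [Set.toFinset_inj] at hst
    exact SetLike.coe_injective (Set.image_injective.2 Subtype.val_injective hst)
  · intro C hC
    rw [mem_maxChains] at hC
    obtain ⟨h₁, h₂, h₃⟩ := hC
    refine ⟨⟨{c : Set.Icc x y | (c : P) ∈ C}, fun c hc d hd _ => h₂ c hc d hd, fun t ht hCt => ?_⟩,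
      Finset.mem_univ _, ?_⟩
    · refine Set.Subset.antisymm hCt fun u hu => h₃ u u.2.1 u.2.2 fun c hc => ?_
      exact ht.total (hCt (show (⟨c, h₁ c hc⟩ : Set.Icc x y) ∈ {c : Set.Icc x y | (c : P) ∈ C} from hc)) hu
    · ext c
      rw [Set.mem_toFinset]
      constructor
      · rintro ⟨c, hc, rfl⟩
        exact hc
      · exact fun hc => ⟨⟨c, h₁ c hc⟩, hc, rfl⟩

theorem numMaxChains_pos (x y : P) : 0 < numMaxChains x y := by
  exact Nat.card_pos

theorem numMaxChains_self (x : P) : numMaxChains x x = 1 := by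
  classical
  rw [numMaxChains_eq_card_maxChains, Finset.card_eq_one]
  refine ⟨{x}, ?_⟩
  ext C
  rw [mem_maxChains, Finset.mem_singleton]
  constructor
  · rintro ⟨h₁, -, h₃⟩
    have hC : ∀ c ∈ C, c = x := fun c hc => le_antisymm (h₁ c hc).2 (h₁ c hc).1
    refine Finset.eq_singleton_iff_unique_mem.2 ⟨h₃ x le_rfl le_rfl fun c hc => ?_, hC⟩
    exact Or.inl (hC c hc).le
  · rintro rfl
    simp only [Finset.mem_singleton, forall_eq]
    exact ⟨⟨le_rfl, le_rfl⟩, Or.inl le_rfl, fun u h₁ h₂ _ => le_antisymm h₂ h₁⟩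

variable [GradeOrder ℕ P]

theorem insert_mem_maxChains [DecidableEq P] {a : P} {C : Finset P} (ha : a ∈ level x y 1)
    (hC : C ∈ maxChains a y) : insert x C ∈ maxChains x y := by
  rw [mem_level] at ha
  rw [mem_maxChains] at hC ⊢
  obtain ⟨h₁, h₂, h₃⟩ := hC
  have haC : a ∈ C := h₃ a le_rfl ha.2.1 fun c hc => Or.inr (h₁ c hc).1
  refine ⟨fun c hc => ?_, fun c hc d hd => ?_, fun u hxu huy hu => ?_⟩
  · rcases Finset.mem_insert.1 hc with rfl | hc
    · exact ⟨le_rfl, ha.1.trans ha.2.1⟩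
    · exact ⟨ha.1.trans (h₁ c hc).1, (h₁ c hc).2⟩
  · rcases Finset.mem_insert.1 hc with hc | hc <;> rcases Finset.mem_insert.1 hd with hd | hd
    · exact Or.inl (hc.trans hd.symm).le
    · exact Or.inl (hc ▸ ha.1.trans (h₁ d hd).1)
    · exact Or.inr (hd ▸ ha.1.trans (h₁ c hc).1)
    · exact h₂ c hc d hd
  · rw [Finset.mem_insert]
    rcases hu a (Finset.mem_insert_of_mem haC) with hau | hua
    · exact Or.inr (h₃ u hau huy fun c hc => hu c (Finset.mem_insert_of_mem hc))
    · by_cases hux : u = x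
      · exact Or.inl hux
      have hgu := grade_lt_of_lt (lt_of_le_of_ne hxu (Ne.symm hux))
      rw [eq_of_le_of_grade_le hua (by omega)]
      exact Or.inr haC

theorem erase_mem_maxChains [DecidableEq P] (hxy : x < y) {C : Finset P}
    (hC : C ∈ maxChains x y) : ∃ a ∈ level x y 1, C.erase x ∈ maxChains a y := by
  rw [mem_maxChains] at hC
  obtain ⟨h₁, h₂, h₃⟩ := hC
  have hyC : y ∈ C := h₃ y hxy.le le_rfl fun c hc => Or.inl (h₁ c hc).2
  -- The least element of the chain above `x` covers `x`, since anything in between could be added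
  -- to the maximal chain.
  obtain ⟨a, ha⟩ := (C.erase x).exists_minimal ⟨y, Finset.mem_erase.2 ⟨hxy.ne', hyC⟩⟩
  have haC := Finset.mem_erase.1 ha.1
  have hmin : ∀ c ∈ C.erase x, a ≤ c := fun c hc =>
    (h₂ a haC.2 c (Finset.mem_of_mem_erase hc)).elim id fun h => ha.2 hc h
  have hxa : x < a := lt_of_le_of_ne (h₁ a haC.2).1 haC.1.symm
  have hcov : x ⋖ a := by
    refine ⟨hxa, fun u hxu hua => ?_⟩
    have huC : u ∈ C := by
      refine h₃ u hxu.le (hua.le.trans (h₁ a haC.2).2) fun c hc => ?_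
      by_cases hcx : c = x
      · exact Or.inl (hcx ▸ hxu.le)
      · exact Or.inr (hua.le.trans (hmin c (Finset.mem_erase.2 ⟨hcx, hc⟩)))
    exact hua.not_ge (hmin u (Finset.mem_erase.2 ⟨hxu.ne', huC⟩))
  refine ⟨a, mem_level.2 ⟨hxa.le, (h₁ a haC.2).2, grade_of_covBy hcov⟩, mem_maxChains.2
    ⟨fun c hc => ⟨hmin c hc, (h₁ c (Finset.mem_of_mem_erase hc)).2⟩,
      fun c hc d hd => h₂ c (Finset.mem_of_mem_erase hc) d (Finset.mem_of_mem_erase hd),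
      fun u hau huy hu => Finset.mem_erase.2 ⟨(hxa.trans_le hau).ne', ?_⟩⟩⟩
  refine h₃ u (hxa.le.trans hau) huy fun c hc => ?_
  by_cases hcx : c = x
  · exact Or.inl (hcx ▸ (hxa.le.trans hau))
  · exact hu c (Finset.mem_erase.2 ⟨hcx, hc⟩)

theorem numMaxChains_eq_sum (hxy : x < y) :
    numMaxChains x y = ∑ a ∈ level x y 1, numMaxChains a y := by
  classical
  simp only [numMaxChains_eq_card_maxChains]
  rw [← Finset.card_sigma]
  have hmin : ∀ a C, a ∈ level x y 1 → C ∈ maxChains a y → a ∈ C ∧ (∀ c ∈ C, a ≤ c) ∧ x ∉ C := by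
    intro a C ha hC
    have hxa := lt_of_mem_level_one ha
    rw [mem_maxChains] at hC
    exact ⟨hC.2.2 a le_rfl (mem_level.1 ha).2.1 fun c hc => Or.inr (hC.1 c hc).1,
      fun c hc => (hC.1 c hc).1, fun hx => hxa.not_ge (hC.1 x hx).1⟩
  symm
  refine Finset.card_bij (fun p _ => insert x p.2) ?_ ?_ ?_
  · rintro ⟨a, C⟩ h
    rw [Finset.mem_sigma] at h
    exact insert_mem_maxChains h.1 h.2
  · rintro ⟨a, C⟩ h ⟨b, D⟩ h' hCD
    rw [Finset.mem_sigma] at h h'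
    obtain ⟨h₁, h₂, h₃⟩ := hmin a C h.1 h.2
    obtain ⟨h₁', h₂', h₃'⟩ := hmin b D h'.1 h'.2
    have : C = D := by
      rw [← Finset.erase_insert h₃, ← Finset.erase_insert h₃']
      exact congrArg (fun s => Finset.erase s x) hCD
    subst this
    rw [le_antisymm (h₂ b h₁') (h₂' a h₁)]
  · intro C hC
    obtain ⟨a, ha, hC'⟩ := erase_mem_maxChains hxy hC
    refine ⟨⟨a, C.erase x⟩, Finset.mem_sigma.2 ⟨ha, hC'⟩, Finset.insert_erase ?_⟩
    rw [mem_maxChains] at hC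
    exact hC.2.2 x le_rfl hxy.le fun c hc => Or.inr (hC.1 c hc).1

end MaximalChains

/-! ### Atom counts in triangular posets. -/

section Triangular

variable {P : Type*} [PartialOrder P] [Fintype P] [GradeMinOrder ℕ P]

/-- In a triangular poset the number of atoms of an interval depends only on the ranks of its
endpoints. -/
theorem IsTriangular.card_level_one_eq (hT : IsTriangular P) {x y u v : P} (hxy : x < y)
    (huv : u < v) (hxu : grade ℕ x = grade ℕ u) (hyv : grade ℕ y = grade ℕ v) :
    (level x y 1).card = (level u v 1).card := by
  obtain ⟨a₀, ha₀⟩ := level_one_nonempty hxy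
  rw [mem_level] at ha₀
  have hsum := hT x y u v hxy.le huv.le hxu hyv
  have hx : ∀ a ∈ level x y 1, numMaxChains a y = numMaxChains a₀ y := by
    intro a ha
    rw [mem_level] at ha
    exact hT _ _ _ _ ha.2.1 ha₀.2.1 (ha.2.2.trans ha₀.2.2.symm) rfl
  have hu : ∀ a ∈ level u v 1, numMaxChains a v = numMaxChains a₀ y := by
    intro a ha
    rw [mem_level] at ha
    exact hT _ _ _ _ ha.2.1 ha₀.2.1 (by omega) hyv.symm
  rw [numMaxChains_eq_sum hxy, numMaxChains_eq_sum huv, Finset.sum_const_nat hx,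
    Finset.sum_const_nat hu] at hsum
  exact Nat.eq_of_mul_eq_mul_right (numMaxChains_pos a₀ y) hsum

end Triangular

/-! ### The Euler relation and the induction on rank. -/

section Eulerian

variable {P : Type*} [PartialOrder P] [Fintype P] [GradeMinOrder ℕ P] {x y : P}

/-- Count pairs of an atom `v` and an element `z` of rank `k + 1` above it: [v, y] is boolean of
rank `m - 1`, and each `z` has `k + 1` atoms. -/
theorem IsSemiBooleanInterval.card_level (h : IsSemiBooleanInterval x y) {m k : ℕ}
    (hm : grade ℕ y = grade ℕ x + m) (hk : k + 1 < m) :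
    (k + 1) * (level x y (k + 1)).card = (level x y 1).card * (m - 1).choose k := by
  have hsum := sum_card_level (x := x) (y := y) k
  rw [Finset.sum_const_nat (m := (m - 1).choose k), Finset.sum_const_nat (m := k + 1)] at hsum
  · rw [hsum, mul_comm]
  · intro z hz
    rw [mem_level] at hz
    rw [h.card_level_one hz.1 (lt_of_le_of_ne hz.2.1 fun h => ?_), hz.2.2,
      Nat.add_sub_cancel_left]
    have := hz.2.2
    rw [h] at this
    omega
  · intro v hv
    have hvy := lt_top_of_mem_level_one hv (by omega)
    rw [(h v (lt_of_mem_level_one hv) hvy).2.card_level hvy.le, hm, (mem_level.1 hv).2.2]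
    congr 1
    omega

namespace IsEulerian

theorem sum_level_eq_zero (hE : IsEulerian P) (hxy : x < y) {n : ℕ}
    (hn : grade ℕ y = grade ℕ x + n) :
    ∑ k ∈ Finset.range (n + 1), (-1 : ℤ) ^ k * (level x y k).card = 0 := by
  classical
  set S : Finset P := {z | x ≤ z ∧ z ≤ y} with hS
  have hmemS : ∀ z, z ∈ S ↔ x ≤ z ∧ z ≤ y := fun z => by simp [hS]
  have hEO := hE x y hxy
  have he : {z ∈ Set.Icc x y | Even (grade ℕ z)} = ({z ∈ S | Even (grade ℕ z)} : Finset P) := by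
    ext z
    simp [hmemS]
  have ho : {z ∈ Set.Icc x y | Odd (grade ℕ z)} =
      ({z ∈ S | ¬ Even (grade ℕ z)} : Finset P) := by
    ext z
    simp [hmemS]
  rw [he, ho, Set.ncard_coe_finset, Set.ncard_coe_finset] at hEO
  have h₀ : ∑ z ∈ S, (-1 : ℤ) ^ grade ℕ z = 0 := by
    rw [← Finset.sum_filter_add_sum_filter_not S (fun z => Even (grade ℕ z)),
      Finset.sum_congr rfl (g := fun _ => (1 : ℤ)), Finset.sum_congr (s₂ :=
        {z ∈ S | ¬ Even (grade ℕ z)}) rfl (g := fun _ => (-1 : ℤ))]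
    · simp only [Finset.sum_const, hEO]
      simp
    · intro z hz
      exact (Nat.not_even_iff_odd.1 (Finset.mem_filter.1 hz).2).neg_one_pow
    · intro z hz
      exact (Finset.mem_filter.1 hz).2.neg_one_pow
  have hmaps : ∀ z ∈ S, grade ℕ z - grade ℕ x ∈ Finset.range (n + 1) := by
    intro z hz
    have := grade_le_of_le ((hmemS z).1 hz).2
    rw [Finset.mem_range]
    omega
  rw [← Finset.sum_fiberwise_of_maps_to hmaps] at h₀
  have h₁ : ∑ k ∈ Finset.range (n + 1), (-1 : ℤ) ^ grade ℕ x *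
      ((-1 : ℤ) ^ k * (level x y k).card) = 0 := by
    rw [← h₀]
    refine Finset.sum_congr rfl fun k _ => ?_
    have hl : level x y k = {z ∈ S | grade ℕ z - grade ℕ x = k} := by
      ext z
      rw [mem_level, Finset.mem_filter, hmemS, and_assoc]
      refine and_congr_right fun h => and_congr_right fun _ => ?_
      have := grade_le_of_le h
      omega
    rw [← hl, Finset.sum_congr rfl (g := fun _ => (-1 : ℤ) ^ grade ℕ x * (-1 : ℤ) ^ k)]
    · rw [Finset.sum_const, nsmul_eq_mul]
      ring
    · intro z hz
      rw [(mem_level.1 hz).2.2, pow_add]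
  rw [← Finset.mul_sum] at h₁
  exact (mul_eq_zero.1 h₁).resolve_left (pow_ne_zero _ (by norm_num))

theorem card_level_one_of_rank_two (hE : IsEulerian P) (hxy : x ≤ y)
    (hn : grade ℕ y = grade ℕ x + 2) : (level x y 1).card = 2 := by
  have hlt : x < y := lt_of_le_of_ne hxy fun h => by rw [h] at hn; omega
  have h := hE.sum_level_eq_zero hlt hn
  simp only [Finset.sum_range_succ, Finset.sum_range_zero, level_zero hxy, level_top hxy hn,
    Finset.card_singleton] at h
  norm_num at h
  omega

theorem numMaxChains_of_rank_two (hE : IsEulerian P) (hxy : x ≤ y)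
    (hn : grade ℕ y = grade ℕ x + 2) : numMaxChains x y = 2 := by
  have hlt : x < y := lt_of_le_of_ne hxy fun h => by rw [h] at hn; omega
  rw [numMaxChains_eq_sum hlt, Finset.sum_const_nat (m := 1),
    hE.card_level_one_of_rank_two hxy hn]
  intro a ha
  have hay := lt_top_of_mem_level_one ha (by omega)
  rw [mem_level] at ha
  rw [numMaxChains_eq_sum hay, level_top hay.le (by omega), Finset.sum_singleton,
    numMaxChains_self]

theorem card_level_one_of_rank_three (hE : IsEulerian P) (hxy : x ≤ y)
    (hn : grade ℕ y = grade ℕ x + 3) (h6 : numMaxChains x y = 6) : (level x y 1).card = 3 := by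
  have hlt : x < y := lt_of_le_of_ne hxy fun h => by rw [h] at hn; omega
  rw [numMaxChains_eq_sum hlt, Finset.sum_const_nat (m := 2)] at h6
  · omega
  · intro a ha
    rw [mem_level] at ha
    exact hE.numMaxChains_of_rank_two ha.2.1 (by omega)

/-- There are three atoms and three coatoms, each atom below two coatoms and each coatom above two
atoms. Distinct coatoms have distinct atom pairs, so the incidences form a triangle. -/
theorem isBooleanInterval_of_rank_three (hE : IsEulerian P) (hxy : x ≤ y)
    (hn : grade ℕ y = grade ℕ x + 3) (h6 : numMaxChains x y = 6) : IsBooleanInterval x y := by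
  classical
  have hA := hE.card_level_one_of_rank_three hxy hn h6
  have hup : ∀ v ∈ level x y 1, (level v y 1).card = 2 := fun v hv => by
    rw [mem_level] at hv
    exact hE.card_level_one_of_rank_two hv.2.1 (by omega)
  have hdown : ∀ z ∈ level x y 2, (level x z 1).card = 2 := fun z hz => by
    rw [mem_level] at hz
    exact hE.card_level_one_of_rank_two hz.1 hz.2.2
  have hB : (level x y 2).card = 3 := by
    have := sum_card_level (x := x) (y := y) 1
    rw [Finset.sum_const_nat hup, Finset.sum_const_nat hdown] at this
    omega
  have hinj : ∀ z ∈ level x y 2, ∀ w ∈ level x y 2, level x z 1 = level x w 1 → z = w := by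
    intro z hz w hw hzw
    by_contra hne
    -- If two coatoms had the same pair of atoms, the third atom `a` would be left with at most one
    -- coatom instead of two.
    obtain ⟨a, ha, haz⟩ := Finset.exists_mem_notMem_of_card_lt_card
      (s := level x z 1) (t := level x y 1) (by rw [hA, hdown z hz]; norm_num)
    have haw : a ∉ level x w 1 := hzw ▸ haz
    have ha' := mem_level.1 ha
    have hsub : level a y 1 ⊆ ((level x y 2).erase z).erase w := by
      intro e he
      rw [mem_level] at he
      refine Finset.mem_erase.2 ⟨?_, Finset.mem_erase.2 ⟨?_, mem_level.2
        ⟨ha'.1.trans he.1, he.2.1, by omega⟩⟩⟩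
      · rintro rfl
        exact haw (mem_level.2 ⟨ha'.1, he.1, ha'.2.2⟩)
      · rintro rfl
        exact haz (mem_level.2 ⟨ha'.1, he.1, ha'.2.2⟩)
    have hc := Finset.card_le_card hsub
    rw [Finset.card_erase_of_mem (Finset.mem_erase.2 ⟨Ne.symm hne, hw⟩),
      Finset.card_erase_of_mem hz, hB, hup a ha] at hc
    omega
  have hcard : ∀ z, x ≤ z → z ≤ y → (level x z 1).card = grade ℕ z - grade ℕ x := by
    intro z h₁ h₂
    have g₁ := grade_le_of_le h₁
    have g₂ := grade_le_of_le h₂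
    obtain hr | hr | hr | hr : grade ℕ z = grade ℕ x ∨ grade ℕ z = grade ℕ x + 1 ∨
        grade ℕ z = grade ℕ x + 2 ∨ grade ℕ z = grade ℕ y := by omega
    · rw [← eq_of_le_of_grade_le h₁ hr.le, level_one_self, Nat.sub_self, Finset.card_empty]
    · rw [level_top h₁ hr, Finset.card_singleton, hr, Nat.add_sub_cancel_left]
    · rw [hdown z (mem_level.2 ⟨h₁, h₂, hr⟩), hr, Nat.add_sub_cancel_left]
    · rw [eq_of_le_of_grade_le h₂ hr.ge, hA, hn, Nat.add_sub_cancel_left]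
  refine ⟨fun z => level x z 1, fun z w h₁ h₂ h₃ h₄ => ⟨fun hs => ?_, level_one_mono⟩,
    fun T _ hT => ?_⟩
  · have hc := Finset.card_le_card hs
    simp only [hcard z h₁ h₂, hcard w h₃ h₄] at hc
    have g₁ := grade_le_of_le h₁
    have g₂ := grade_le_of_le h₂
    have g₃ := grade_le_of_le h₃
    have g₄ := grade_le_of_le h₄
    obtain hr | hr | hr | hr : grade ℕ z = grade ℕ x ∨ grade ℕ z = grade ℕ x + 1 ∨
        (grade ℕ z = grade ℕ x + 2 ∧ grade ℕ w = grade ℕ x + 2) ∨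
          grade ℕ w = grade ℕ y := by omega
    · rwa [← eq_of_le_of_grade_le h₁ hr.le]
    · exact (mem_level.1 (hs (mem_level.2 ⟨h₁, le_rfl, hr⟩))).2.1
    · have hz := mem_level.2 ⟨h₁, h₂, hr.1⟩
      have hw := mem_level.2 ⟨h₃, h₄, hr.2⟩
      exact (hinj z hz w hw (Finset.eq_of_subset_of_card_le hs
        (by rw [hdown z hz, hdown w hw]))).le
    · rwa [eq_of_le_of_grade_le h₄ hr.ge]
  · have hc := Finset.card_le_card hT
    simp only [hA] at hc
    obtain hr | hr | hr | hr : T.card = 0 ∨ T.card = 1 ∨ T.card = 2 ∨ T.card = 3 := by omega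
    · exact ⟨x, le_rfl, hxy, by simp [level_one_self, Finset.card_eq_zero.1 hr]⟩
    · obtain ⟨a, rfl⟩ := Finset.card_eq_one.1 hr
      have ha := mem_level.1 (hT (Finset.mem_singleton_self a))
      exact ⟨a, ha.1, ha.2.1, level_top ha.1 ha.2.2⟩
    · obtain ⟨z, hz, hzT⟩ := Finset.surj_on_of_inj_on_of_card_le
        (s := level x y 2) (t := (level x y 1).powersetCard 2) (fun z _ => level x z 1)
        (fun z hz => Finset.mem_powersetCard.2
          ⟨level_one_mono (mem_level.1 hz).2.1, hdown z hz⟩)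
        (fun z w hz hw => hinj z hz w hw)
        (by rw [Finset.card_powersetCard, hA, hB]; decide) T (Finset.mem_powersetCard.2 ⟨hT, hr⟩)
      exact ⟨z, (mem_level.1 hz).1, (mem_level.1 hz).2.1, hzT.symm⟩
    · exact ⟨y, hxy, le_rfl, (Finset.eq_of_subset_of_card_le hT (by simp [hA, hr])).symm⟩

end IsEulerian

/-- If only one of `p`, `q` is large, one of `a`, `c` is at most half the other, so `n * (a + c)` is
at most 3n/2 times the larger; this does not exceed `2 * (a * p)` exactly because `4 ≤ n`. If both
are large, 2ap = ap + cq is at least 2(n - 1)(a + c). Either way the extra `2 * n` gives a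
contradiction. -/
theorem eq_of_atom_coatom_counts {n a c p q : ℕ} (hn : 4 ≤ n)
    (hp : p = n - 1 ∨ 2 * (n - 1) ≤ p) (hq : q = n - 1 ∨ 2 * (n - 1) ≤ q)
    (hac : a * p = c * q) (h : n * (a + c) = 2 * n + 2 * (a * p)) :
    p = n - 1 ∧ q = n - 1 ∧ a = n := by
  obtain ⟨m, rfl⟩ := Nat.exists_eq_add_of_le' hn
  simp only [show m + 4 - 1 = m + 3 by omega] at *
  rcases hp with rfl | hp <;> rcases hq with rfl | hq
  · have : a = c := Nat.eq_of_mul_eq_mul_right (by omega) hac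
    subst this
    refine ⟨rfl, rfl, ?_⟩
    nlinarith
  · exfalso
    have h₁ : c * (2 * (m + 3)) ≤ a * (m + 3) := hac ▸ Nat.mul_le_mul_left c hq
    have h₂ : 2 * c ≤ a := Nat.le_of_mul_le_mul_right (by nlinarith) (show 0 < m + 3 by omega)
    nlinarith
  · exfalso
    have h₁ : a * (2 * (m + 3)) ≤ c * (m + 3) := hac ▸ Nat.mul_le_mul_left a hp
    have h₂ : 2 * a ≤ c := Nat.le_of_mul_le_mul_right (by nlinarith) (show 0 < m + 3 by omega)
    nlinarith
  · exfalso
    have h₁ := Nat.mul_le_mul_left a hp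
    have h₂ := Nat.mul_le_mul_left c hq
    nlinarith

/-- Levels 2 to `m + 2` are proportional to binomial coefficients, so the vanishing alternating sum
of the binomial coefficients eliminates them from the Euler relation. Only the two bottom and two
top levels remain. -/
theorem IsEulerian.mul_card_atoms_add_card_coatoms (hE : IsEulerian P) (hxy : x < y) {m b : ℕ} (hm : Even m)
    (hn : grade ℕ y = grade ℕ x + (m + 4))
    (hN : ∀ k ≤ m, (m + 4) * (m + 3) * (level x y (k + 2)).card = b * (m + 4).choose (k + 2)) :
    (m + 4) * ((level x y 1).card + (level x y (m + 3)).card) = 2 * (m + 4) + 2 * b := by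
  have h₁ := hE.sum_level_eq_zero hxy hn
  have h₂ := Int.alternating_sum_range_choose_of_ne (n := m + 4) (by omega)
  rw [Finset.sum_range_succ, Finset.sum_range_succ, Finset.sum_range_succ',
    Finset.sum_range_succ'] at h₁ h₂
  have h₃ : ∑ k ∈ Finset.range (m + 1), (-1 : ℤ) ^ (k + 1 + 1) * (m + 4).choose (k + 1 + 1) * b
      = ∑ k ∈ Finset.range (m + 1),
        ((-1 : ℤ) ^ (k + 1 + 1) * (level x y (k + 1 + 1)).card) * ((m + 4) * (m + 3)) := by
    refine Finset.sum_congr rfl fun k hk => ?_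
    have := hN k (by rw [Finset.mem_range] at hk; omega)
    have : ((m + 4) * (m + 3) * (level x y (k + 2)).card : ℤ) = b * (m + 4).choose (k + 2) :=
      mod_cast this
    linear_combination -(-1 : ℤ) ^ (k + 2) * this
  rw [← Finset.sum_mul, ← Finset.sum_mul] at h₃
  have hc : (m + 4).choose (m + 3) = m + 4 := Nat.choose_succ_self_right (m + 3)
  simp only [level_zero hxy.le, level_top hxy.le hn, Finset.card_singleton, zero_add,
    Nat.choose_self, Nat.choose_zero_right, Nat.choose_one_right, hc] at h₁ h₂
  have e₁ : (-1 : ℤ) ^ (m + 3) = -1 := (hm.add_odd (by decide)).neg_one_pow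
  have e₂ : (-1 : ℤ) ^ (m + 4) = 1 := (hm.add (by decide)).neg_one_pow
  rw [e₁, e₂] at h₁ h₂
  push_cast at h₁ h₂
  refine Nat.eq_of_mul_eq_mul_right (show 0 < m + 3 by omega) ?_
  zify
  linear_combination (m + 4) * (m + 3) * h₁ * (-1 : ℤ) + b * h₂ - h₃

/-- The induction step for intervals of even rank. -/
theorem IsEulerian.isBooleanInterval_of_even (hE : IsEulerian P) (hT : IsTriangular P)
    (hxy : x ≤ y) {n : ℕ} (hn : 4 ≤ n) (heven : Even n) (hxyn : grade ℕ y = grade ℕ x + n)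
    (H : ∀ u v : P, u ≤ v → grade ℕ v = grade ℕ u + (n - 1) → IsSemiBooleanInterval u v ∧
      (IsBooleanInterval u v ∨ 2 * (n - 1) ≤ (level u v 1).card)) :
    IsBooleanInterval x y := by
  have hlt : x < y := lt_of_le_of_ne hxy fun h => by rw [h] at hxyn; omega
  obtain ⟨v₀, hv₀⟩ := level_one_nonempty hlt
  obtain ⟨w₀, hxw₀, hw₀y⟩ := exists_le_covBy_of_lt hlt
  have hgw₀ := grade_of_covBy hw₀y
  have hrank : ∀ v ∈ level x y 1, v < y ∧ grade ℕ y = grade ℕ v + (n - 1) := fun v hv =>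
    ⟨lt_top_of_mem_level_one hv (by omega), by have := (mem_level.1 hv).2.2; omega⟩
  have hp : ∀ v ∈ level x y 1, (level v y 1).card = (level v₀ y 1).card := fun v hv =>
    hT.card_level_one_eq (hrank v hv).1 (hrank v₀ hv₀).1
      ((mem_level.1 hv).2.2.trans (mem_level.1 hv₀).2.2.symm) rfl
  have hcoatom : ∀ w, w ≤ y → grade ℕ y = grade ℕ w + 1 → x ≤ w → x < w := fun w _ hg hxw =>
    lt_of_le_of_ne hxw fun h => by rw [← h] at hg; omega
  have hq : ∀ w, x ≤ w → w ≤ y → grade ℕ y = grade ℕ w + 1 →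
      (level x w 1).card = (level x w₀ 1).card := fun w hxw hwy hg =>
    hT.card_level_one_eq (hcoatom w hwy hg hxw) (hcoatom w₀ hw₀y.le hgw₀ hxw₀) rfl (by omega)
  -- Such a `z` lies strictly below a coatom `w`, and [x, w] is semi-boolean.
  have hlow : ∀ z, x < z → z ≤ y → grade ℕ z + 2 ≤ grade ℕ y → IsBooleanInterval x z := by
    intro z hxz hzy hg
    obtain ⟨w, hzw, hwy⟩ := exists_le_covBy_of_lt
      (lt_of_le_of_ne hzy fun h => by rw [h] at hg; omega)
    have hgw := grade_of_covBy hwy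
    exact ((H x w (hxz.le.trans hzw) (by omega)).1 z hxz
      (lt_of_le_of_ne hzw fun h => by rw [h] at hg; omega)).1
  obtain ⟨m, rfl⟩ := Nat.exists_eq_add_of_le' hn
  simp only [show m + 4 - 1 = m + 3 by omega] at *
  set a := (level x y 1).card with ha
  set c := (level x y (m + 3)).card with hc
  set p := (level v₀ y 1).card with hp'
  set q := (level x w₀ 1).card with hq'
  have hup : ∀ v ∈ level x y 1, ∀ k, k ≤ m + 1 →
      (k + 1) * (level v y (k + 1)).card = p * (m + 2).choose k := by
    intro v hv k hk
    rw [← hp v hv]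
    exact (H v y (hrank v hv).1.le (hrank v hv).2).1.card_level (hrank v hv).2 (by omega)
  have hdc : ∀ k, k ≤ m + 1 → (k + 1) * ∑ z ∈ level x y (k + 2), (level x z 1).card =
      a * (p * (m + 2).choose k) := by
    intro k hk
    rw [← sum_card_level (k + 1), Finset.mul_sum, Finset.sum_const_nat fun v hv => hup v hv k hk]
  -- Both sides count the pairs of an atom below a coatom; in the semi-boolean interval [v, y] there
  -- are as many coatoms as atoms.
  have hac : a * p = c * q := by
    have := hdc (m + 1) le_rfl
    rw [Finset.sum_const_nat (m := q) fun z hz => ?_, Nat.choose_succ_self_right] at this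
    · refine (Nat.eq_of_mul_eq_mul_right (show 0 < m + 2 by omega) ?_).symm
      linear_combination this
    · rw [mem_level] at hz
      exact hq z hz.1 hz.2.1 (by omega)
  have hN : ∀ k ≤ m, (m + 4) * (m + 3) * (level x y (k + 2)).card =
      a * p * (m + 4).choose (k + 2) := by
    intro k hk
    have := hdc k (by omega)
    rw [Finset.sum_const_nat (m := k + 2) fun z hz => ?_] at this
    · have c₁ := Nat.add_one_mul_choose_eq (m + 2) k
      have c₂ := Nat.add_one_mul_choose_eq (m + 3) (k + 1)
      refine Nat.eq_of_mul_eq_mul_right (show 0 < (k + 1) * (k + 2) by positivity) ?_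
      zify at this c₁ c₂ ⊢
      linear_combination (m + 4) * (m + 3) * this + a * p * (m + 4) * c₁ + a * p * (k + 1) * c₂
    · rw [mem_level] at hz
      have hxz : x < z := lt_of_le_of_ne hz.1 fun h => by have := hz.2.2; rw [← h] at this; omega
      rw [(hlow z hxz hz.2.1 (by omega)).card_level_one hz.1, hz.2.2, Nat.add_sub_cancel_left]
  have heuler := hE.mul_card_atoms_add_card_coatoms hlt
    ((Nat.even_add.1 heven).2 (by decide)) hxyn hN
  have hpB := (H v₀ y (hrank v₀ hv₀).1.le (hrank v₀ hv₀).2).2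
  have hqB := (H x w₀ hxw₀ (by omega)).2
  have hp₁ : p = m + 3 ∨ 2 * (m + 3) ≤ p := hpB.imp_left fun h => by
    rw [hp', h.card_level_one (hrank v₀ hv₀).1.le, (hrank v₀ hv₀).2, Nat.add_sub_cancel_left]
  have hq₁ : q = m + 3 ∨ 2 * (m + 3) ≤ q := hqB.imp_left fun h => by
    rw [hq', h.card_level_one hxw₀]
    omega
  obtain ⟨hp₂, hq₂, ha₂⟩ := eq_of_atom_coatom_counts (by omega) hp₁ hq₁ hac heuler
  -- As `p` and `q` equal `m + 3`, which is less than `2 * (m + 3)`, every interval from an atom to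
  -- `y` or from `x` to a coatom is boolean.
  have hS : IsSemiBooleanInterval x y := by
    intro z hxz hzy
    obtain ⟨v, hxv, hvz⟩ := exists_covBy_le_of_lt hxz
    obtain ⟨w, hzw, hwy⟩ := exists_le_covBy_of_lt hzy
    have hv : v ∈ level x y 1 := mem_level.2 ⟨hxv.le, hvz.trans hzy.le, grade_of_covBy hxv⟩
    have hgw := grade_of_covBy hwy
    have hxw := hxz.le.trans hzw
    constructor
    · refine ((H x w hxw (by omega)).2.resolve_right ?_).mono le_rfl hxz.le hzw
      rw [hq w hxw hwy.le hgw]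
      omega
    · refine ((H v y (hrank v hv).1.le (hrank v hv).2).2.resolve_right ?_).mono hvz hzy.le le_rfl
      rw [hp v hv]
      omega
  -- The interval has only `m + 4` atoms, too few for two classes.
  refine (hS.isBooleanInterval_or_le_card (by omega) hlt).resolve_right fun h => ?_
  omega

/-- The intervals of odd rank are semi-boolean and those of even rank are boolean. -/
theorem IsEulerian.isSemiBooleanInterval (hE : IsEulerian P) (hT : IsTriangular P)
    (h6 : ∀ x y : P, x ≤ y → grade ℕ y = grade ℕ x + 3 → numMaxChains x y = 6) (n : ℕ) :
    ∀ x y : P, x ≤ y → grade ℕ y = grade ℕ x + (n + 3) → IsSemiBooleanInterval x y ∧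
      (IsBooleanInterval x y ∨ 2 * (n + 3) ≤ (level x y 1).card) ∧
        (Odd n → IsBooleanInterval x y) := by
  induction n with
  | zero =>
    intro x y hxy hn
    have h := hE.isBooleanInterval_of_rank_three hxy hn (h6 x y hxy hn)
    exact ⟨h.isSemiBooleanInterval, Or.inl h, fun _ => h⟩
  | succ n ih =>
    intro x y hxy hn
    have hlt : x < y := lt_of_le_of_ne hxy fun h => by rw [h] at hn; omega
    -- The rank is now `n + 4`, so it has the parity of `n`.
    rcases Nat.even_or_odd n with heven | hodd
    · have h : IsBooleanInterval x y := hE.isBooleanInterval_of_even hT hxy (n := n + 4)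
        (by omega) (heven.add (by decide)) hn fun u v huv h =>
          ⟨(ih u v huv h).1, (ih u v huv h).2.1⟩
      exact ⟨h.isSemiBooleanInterval, Or.inl h, fun _ => h⟩
    · have hS : IsSemiBooleanInterval x y := by
        intro z hxz hzy
        obtain ⟨v, hxv, hvz⟩ := exists_covBy_le_of_lt hxz
        obtain ⟨w, hzw, hwy⟩ := exists_le_covBy_of_lt hzy
        have hgv := grade_of_covBy hxv
        have hgw := grade_of_covBy hwy
        exact ⟨((ih x w (hxz.le.trans hzw) (by omega)).2.2 hodd).mono le_rfl hxz.le hzw,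
          ((ih v y (hvz.trans hzy.le) (by omega)).2.2 hodd).mono hvz hzy.le le_rfl⟩
      refine ⟨hS, ?_, fun h => absurd hodd ?_⟩
      · have := hS.isBooleanInterval_or_le_card (by omega) hlt
        rwa [hn, Nat.add_sub_cancel_left] at this
      · rw [Nat.not_odd_iff_even]
        exact (Nat.odd_add_one.1 h) |> Nat.not_odd_iff_even.1

end Eulerian

/-! ### From interval structure to order isomorphisms. -/

section Isomorphisms

/-- A finite set with an equivalence relation all of whose classes have `n` elements is a product
of the set of classes and an `n`-element set. -/
theorem Setoid.exists_equiv_prod {X : Type*} [Finite X] (r : Setoid X) {n : ℕ}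
    (hr : ∀ a, Nat.card {b // r b a} = n) :
    ∃ (k : ℕ) (e : X ≃ Fin k × Fin n), ∀ a b, (e a).1 = (e b).1 ↔ r a b := by
  have hfib : ∀ q : Quotient r, Nonempty ({a // Quotient.mk r a = q} ≃ Fin n) := by
    intro q
    induction q using Quotient.inductionOn with
    | _ a =>
      refine ⟨(Equiv.subtypeEquivRight fun b => ?_).trans (Finite.equivFinOfCardEq (hr a))⟩
      exact Quotient.eq
  let φ := fun q => (hfib q).some
  refine ⟨Nat.card (Quotient r), ((Equiv.sigmaFiberEquiv (Quotient.mk r)).symm.trans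
    ((Equiv.sigmaCongrRight φ).trans (Equiv.sigmaEquivProd _ _))).trans
      ((Finite.equivFin (Quotient r)).prodCongr (Equiv.refl _)), ?_⟩
  intro a b
  simp only [Equiv.trans_apply, Equiv.prodCongr_apply, Prod.map_fst, EmbeddingLike.apply_eq_iff_eq]
  exact Quotient.eq

/-- A bounded order is obtained from its elements other than the bounds by adding bounds. -/
theorem nonempty_orderIso_withBot_withTop {M P : Type*} [PartialOrder M] [PartialOrder P]
    [BoundedOrder P] (f : M → P) (hf : ∀ s t, f s ≤ f t ↔ s ≤ t) (hbot : ∀ s, ⊥ < f s)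
    (htop : ∀ s, f s < ⊤) (hsurj : ∀ z, ⊥ < z → z < ⊤ → ∃ s, f s = z)
    (hlt : (⊥ : P) < ⊤) : Nonempty (P ≃o WithBot (WithTop M)) := by
  let g : WithBot (WithTop M) → P := WithBot.recBotCoe ⊥ (WithTop.recTopCoe ⊤ f)
  have g_bot : g ⊥ = ⊥ := rfl
  have g_top : g ((⊤ : WithTop M) : WithBot (WithTop M)) = ⊤ := rfl
  have g_coe : ∀ s : M, g ((s : WithTop M) : WithBot (WithTop M)) = f s := fun _ => rfl
  have hg : ∀ s t, g s ≤ g t ↔ s ≤ t := by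
    intro s t
    induction s using WithBot.recBotCoe with
    | bot => exact iff_of_true (g_bot ▸ bot_le) bot_le
    | coe s =>
      induction t using WithBot.recBotCoe with
      | bot =>
        refine iff_of_false ?_ (WithBot.bot_lt_coe s).not_ge
        induction s using WithTop.recTopCoe with
        | top => exact hlt.not_ge
        | coe s => exact (hbot s).not_ge
      | coe t =>
        rw [WithBot.coe_le_coe]
        induction t using WithTop.recTopCoe with
        | top => exact iff_of_true (g_top ▸ le_top) le_top
        | coe t =>
          induction s using WithTop.recTopCoe with
          | top => exact iff_of_false (htop t).not_ge (WithTop.coe_lt_top t).not_ge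
          | coe s =>
            rw [WithTop.coe_le_coe]
            exact hf s t
  refine ⟨(RelIso.ofSurjective (OrderEmbedding.ofMapLEIff g hg) fun z => ?_).symm⟩
  rcases eq_or_ne z ⊥ with rfl | hz
  · exact ⟨⊥, g_bot⟩
  rcases eq_or_ne z ⊤ with rfl | hz'
  · exact ⟨((⊤ : WithTop M) : WithBot (WithTop M)), g_top⟩
  obtain ⟨s, rfl⟩ := hsurj z hz.bot_lt hz'.lt_top
  exact ⟨((s : WithTop M) : WithBot (WithTop M)), g_coe s⟩

variable {P : Type*} [PartialOrder P] [BoundedOrder P] [Fintype P] [GradeMinOrder ℕ P]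

theorem IsBooleanInterval.nonempty_orderIso (h : IsBooleanInterval (⊥ : P) ⊤) {n : ℕ}
    (hn : grade ℕ (⊤ : P) = n) : Nonempty (P ≃o BooleanLattice n) := by
  classical
  have hA := h.card_level_one bot_le
  rw [hn, grade_bot, Nat.bot_eq_zero, Nat.sub_zero] at hA
  let e : level (⊥ : P) ⊤ 1 ≃ Fin n := Finset.equivFinOfCardEq hA
  let g : P → Finset (Fin n) := fun z => {i | (e.symm i : P) ≤ z}
  have hg : ∀ z i, i ∈ g z ↔ (e.symm i : P) ≤ z := fun z i => by simp [g]
  have hle : ∀ z w, g z ≤ g w ↔ z ≤ w := by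
    refine fun z w => ⟨fun hs => ?_, fun hzw i hi => (hg w i).2 (((hg z i).1 hi).trans hzw)⟩
    refine h.le_of_level_one_subset bot_le le_top bot_le le_top fun a ha => ?_
    have ha' := level_one_mono le_top ha
    have := hs ((hg z (e ⟨a, ha'⟩)).2 (by simpa using (mem_level.1 ha).2.1))
    rw [hg, Equiv.symm_apply_apply] at this
    exact mem_level.2 ⟨bot_le, this, (mem_level.1 ha).2.2⟩
  refine ⟨RelIso.ofSurjective (OrderEmbedding.ofMapLEIff g hle) fun S => ?_⟩
  obtain ⟨z, -, -, hz⟩ := h.exists_level_one_eq bot_le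
    (T := S.image fun i => (e.symm i : P)) (by
      intro a ha
      obtain ⟨i, -, rfl⟩ := Finset.mem_image.1 ha
      exact (e.symm i).2)
  refine ⟨z, ?_⟩
  change g z = S
  ext i
  have hi := mem_level.1 (e.symm i).2
  have : (e.symm i : P) ≤ z ↔ (e.symm i : P) ∈ level ⊥ z 1 :=
    ⟨fun h => mem_level.2 ⟨bot_le, h, hi.2.2⟩, fun h => (mem_level.1 h).2.1⟩
  rw [hg, this, hz, Finset.mem_image]
  constructor
  · rintro ⟨j, hj, hij⟩
    rwa [← e.symm.injective (Subtype.ext hij)]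
  · exact fun h => ⟨i, h, rfl⟩

theorem IsSemiBooleanInterval.nonempty_orderIso (h : IsSemiBooleanInterval (⊥ : P) ⊤) {n : ℕ}
    (hn : grade ℕ (⊤ : P) = n) (hn4 : 4 ≤ n) :
    ∃ k : ℕ, 1 ≤ k ∧ Nonempty (P ≃o KSum k (BooleanLattice n)) := by
  classical
  have hbot : grade ℕ (⊥ : P) = 0 := by rw [grade_bot, Nat.bot_eq_zero]
  have hr : grade ℕ (⊥ : P) + 4 ≤ grade ℕ (⊤ : P) := by omega
  have hlt : (⊥ : P) < ⊤ := lt_of_le_of_ne bot_le fun h => by rw [h] at hbot; omega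
  let r : Setoid (level (⊥ : P) ⊤ 1) :=
    { r := fun a b => (a : P) ∈ atomClass ⊥ ⊤ (b : P)
      iseqv := ⟨fun a => h.mem_atomClass_self hr a.2, fun {_ b} hab => h.atomClass_comm hr b.2 hab,
        fun {_ b c} hab hbc => h.atomClass_eq hr c.2 hbc ▸ hab⟩ }
  -- Atoms are labelled by pairs: the class, which is the index of a copy, and a position among the
  -- `n` atoms of that class.
  obtain ⟨k, e, he⟩ := r.exists_equiv_prod (n := n) (by
    intro a
    have hc := h.card_atomClass hr a.2
    rw [hbot, hn, Nat.sub_zero] at hc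
    rw [← hc, ← Nat.card_eq_finsetCard]
    exact Nat.card_congr ⟨fun b => ⟨b.1, b.2⟩,
      fun b => ⟨⟨b.1, (mem_atomClass.1 b.2).1⟩, b.2⟩, fun _ => rfl, fun _ => rfl⟩)
  let atom : Fin k → Fin n → P := fun i j => (e.symm (i, j) : P)
  have hatom : ∀ i j, atom i j ∈ level (⊥ : P) ⊤ 1 := fun i j => (e.symm (i, j)).2
  have hatom_inj : ∀ i j i' j', atom i j = atom i' j' → i = i' ∧ j = j' := by
    intro i j i' j' hij
    exact Prod.mk.inj (e.symm.injective (Subtype.ext hij))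
  have hclass : ∀ i j i' j', atom i j ∈ atomClass ⊥ ⊤ (atom i' j') ↔ i = i' := by
    intro i j i' j'
    have := he (e.symm (i, j)) (e.symm (i', j'))
    simp only [Equiv.apply_symm_apply] at this
    exact this.symm
  have hsurj : ∀ a ∈ level (⊥ : P) ⊤ 1, ∃ i j, atom i j = a := fun a ha =>
    ⟨(e ⟨a, ha⟩).1, (e ⟨a, ha⟩).2, by simp [atom]⟩
  obtain ⟨a₀, ha₀⟩ := level_one_nonempty hlt
  obtain ⟨i₀, -, -⟩ := hsurj a₀ ha₀
  refine ⟨k, Nat.one_le_of_lt i₀.2, ?_⟩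
  -- A proper nonempty subset of the positions in copy `s.1` gives a proper nonempty subset of that
  -- class, hence an element of `P`.
  have hex : ∀ s : Σ _ : Fin k, {S : Finset (Fin n) // S ≠ ⊥ ∧ S ≠ ⊤},
      ∃ z : P, ⊥ < z ∧ z < ⊤ ∧ level ⊥ z 1 = (s.2 : Finset (Fin n)).image (atom s.1) := by
    rintro ⟨i, S, hS, hS'⟩
    obtain ⟨j, hj⟩ := Finset.nonempty_iff_ne_empty.2 hS
    refine h.exists_level_one_eq hr (hatom i j) (Finset.mem_image_of_mem _ hj) ⟨?_, fun hs => hS' ?_⟩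
    · intro a ha
      obtain ⟨j', -, rfl⟩ := Finset.mem_image.1 ha
      exact (hclass _ _ _ _).2 rfl
    · refine Finset.eq_univ_of_forall fun j' => ?_
      obtain ⟨j'', hj'', hjj⟩ := Finset.mem_image.1 (hs ((hclass i j' i j).2 rfl))
      rwa [← (hatom_inj _ _ _ _ hjj).2]
  choose f hf₁ hf₂ hf₃ using hex
  have hf : ∀ s t, f s ≤ f t ↔ s ≤ t := by
    intro s t
    constructor
    · intro hst
      have hs := level_one_mono (x := ⊥) hst
      rw [hf₃, hf₃] at hs
      obtain ⟨i, S, hS, hS'⟩ := s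
      obtain ⟨i', T, hT, hT'⟩ := t
      have hsub : ∀ j ∈ S, i = i' ∧ j ∈ T := by
        intro j hj
        obtain ⟨j', hj', hjj⟩ := Finset.mem_image.1 (hs (Finset.mem_image_of_mem _ hj))
        obtain ⟨rfl, rfl⟩ := hatom_inj _ _ _ _ hjj
        exact ⟨rfl, hj'⟩
      obtain ⟨j, hj⟩ := Finset.nonempty_iff_ne_empty.2 hS
      obtain rfl := (hsub j hj).1
      exact Sigma.mk_le_mk_iff.2 fun j hj => (hsub j hj).2
    · rintro ⟨i, S, T, hST⟩
      refine h.le_of_level_one_subset hr bot_le (hf₂ _) bot_le (hf₂ _) ?_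
      rw [hf₃, hf₃]
      exact Finset.image_subset_image hST
  refine nonempty_orderIso_withBot_withTop f hf hf₁ hf₂ (fun z hz hz'' => ?_) hlt
  obtain ⟨a, ha⟩ := level_one_nonempty hz
  obtain ⟨i, j, rfl⟩ := hsurj a (level_one_mono le_top ha)
  -- The atoms below `z` all lie in one class and do not exhaust it, so they determine a copy and a
  -- proper subset.
  obtain ⟨hK₁, hK₂⟩ := h.level_one_ssubset_atomClass hr bot_le hz'' ha
  let S : Finset (Fin n) := {j | atom i j ∈ level ⊥ z 1}
  have hS : ∀ j, j ∈ S ↔ atom i j ∈ level ⊥ z 1 := fun j => by simp [S]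
  have hne : S ≠ ⊥ ∧ S ≠ ⊤ := by
    refine ⟨Finset.nonempty_iff_ne_empty.1 ⟨j, (hS j).2 ha⟩, fun hS' => hK₂ fun b hb => ?_⟩
    obtain ⟨i', j', rfl⟩ := hsurj b (mem_atomClass.1 hb).1
    obtain rfl := (hclass _ _ _ _).1 hb
    exact (hS j').1 (hS' ▸ Finset.mem_univ j')
  have hlev : level ⊥ (f ⟨i, S, hne⟩) 1 = level ⊥ z 1 := by
    rw [hf₃]
    ext b
    rw [Finset.mem_image]
    constructor
    · rintro ⟨j', hj', rfl⟩
      exact (hS j').1 hj'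
    · intro hb
      obtain ⟨i', j', rfl⟩ := hsurj b (level_one_mono le_top hb)
      obtain rfl := (hclass _ _ _ _).1 (hK₁ hb)
      exact ⟨j', (hS j').2 hb, rfl⟩
  refine ⟨⟨i, S, hne⟩, ?_⟩
  exact le_antisymm (h.le_of_level_one_subset hr bot_le (hf₂ _) bot_le hz'' hlev.le)
    (h.le_of_level_one_subset hr bot_le hz'' bot_le (hf₂ _) hlev.ge)

end Isomorphisms

theorem mainTheorem8 {P : Type*} [PartialOrder P] [BoundedOrder P] [Finite P] [GradeMinOrder ℕ P]
    (n : ℕ) (hn : 4 ≤ n) (hrank : grade ℕ (⊤ : P) = n)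
    (hE : IsEulerian P) (hT : IsTriangular P)
    (h6 : ∀ x y : P, x ≤ y → grade ℕ y = grade ℕ x + 3 → numMaxChains x y = 6) :
    (Odd n → ∃ α : ℕ, 1 ≤ α ∧ Nonempty (P ≃o KSum α (BooleanLattice n))) ∧
      (Even n → Nonempty (P ≃o BooleanLattice n)) := by
  have := Fintype.ofFinite P
  -- The induction is indexed by the rank minus 3, which reverses parity.
  obtain ⟨m, rfl⟩ := Nat.exists_eq_add_of_le' (show 3 ≤ n by omega)
  have hgrade : grade ℕ (⊤ : P) = grade ℕ (⊥ : P) + (m + 3) := by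
    rw [hrank, grade_bot, Nat.bot_eq_zero, zero_add]
  obtain ⟨hS, -, hB⟩ := hE.isSemiBooleanInterval hT h6 m ⊥ ⊤ bot_le hgrade
  refine ⟨fun _ => hS.nonempty_orderIso hrank hn, fun heven => ?_⟩
  have hodd : Odd m := Nat.not_even_iff_odd.1 fun hm =>
    absurd heven (Nat.not_even_iff_odd.2 (hm.add_odd (by decide)))
  exact (hB hodd).nonempty_orderIso hrank
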